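/- Let $1\le k\le m_1$ and $1\le q\le m_2$ be integers, and equip $\mathbb{R}^{m_1\times m_2}$ with the Frobenius inner product and norm $\|\cdot\|_F$. For $1\le j\le m$ let $\widetilde{\mathcal A}^m_j$ be the set of vectors $a\in\mathbb{R}^m$ with exactly $j$ non-zero entries, all of absolute value $1/\sqrt j$, and let $$\widetilde{\mathcal A}_{k,q}=\{ab^{\top} : a\in\widetilde{\mathcal A}^{m_1}_k,\ b\in\widetilde{\mathcal A}^{m_2}_q\}.$$ The $(k,q)$-CUT norm is the gauge $\widetilde\Omega_{k,q}(Z)=\inf\{t>0 : Z\in t\,\mathrm{conv}(\widetilde{\mathcal A}_{k,q})\}$. For a convex function $\Omega$ on $\mathbb{R}^{m_1\times m_2}$ and a matrix $Z$, let $$T_\Omega(Z)=\overline{\bigcup_{\tau>0}\{H : \Omega(Z+\tau H)\le\Omega(Z)\}},\qquad \mathfrak S(Z,\Omega)=\mathbb{E}\big[\|\Pi_{T_\Omega(Z)}(G)\|_F^2\big],$$ where $G$ is a random matrix with i.i.d. standard normal entries and $\Pi_T$ is the orthogonal projection onto the closed convex cone $T$ ($\mathfrak S(Z,\Omega)$ is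 the statistical dimension of $\Omega$ at $Z$). Then for every $A\in\widetilde{\mathcal A}_{k,q}$ the expectation defining $\mathfrak S(A,\widetilde\Omega_{k,q})$ is finite, and $$\mathfrak S(A,\widetilde\Omega_{k,q})\ \le\ 16(k+q)+9\Big(k\log\frac{m_1}{k}+q\log\frac{m_2}{q}\Big).$$ Moreover, the unit ball $\{Z : \widetilde\Omega_{k,q}(Z)\le 1\}$ is a vertex-transitive polytope (its isometric symmetries act transitively on its vertices), its vertices are exactly the elements of $\widetilde{\mathcal A}_{k,q}$, and there are $2^{k+q-1}\binom{m_1}{k}\binom{m_2}{q}$ of them. -/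

import Mathlib

namespace SparseCut

open Set MeasureTheory ProbabilityTheory

/-- The space `ℝ^{m₁ × m₂}` of real matrices, with the Frobenius inner product and norm. -/
abbrev RMat (m₁ m₂ : ℕ) : Type := EuclideanSpace ℝ (Fin m₁ × Fin m₂)

/-- The outer product `a bᵀ`. -/
def outer {m₁ m₂ : ℕ} (a : Fin m₁ → ℝ) (b : Fin m₂ → ℝ) : RMat m₁ m₂ :=
  WithLp.toLp 2 fun p => a p.1 * b p.2

/-- The vectors of `ℝ^m` with exactly `k` non-zero entries, all of absolute value `1 / √k`. -/
def flatVec (m k : ℕ) : Set (Fin m → ℝ) :=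
  {a | hammingNorm a = k ∧ ∀ i, a i ≠ 0 → |a i| = 1 / Real.sqrt k}

/-- The atoms `a bᵀ` of the `(k,q)`-CUT norm. -/
def cutAtoms (m₁ m₂ k q : ℕ) : Set (RMat m₁ m₂) :=
  {A | ∃ a ∈ flatVec m₁ k, ∃ b ∈ flatVec m₂ q, A = outer a b}

/-- The gauge function `x ↦ inf {t > 0 : x ∈ t conv(𝒜)}` of a set of atoms. -/
noncomputable def atomicNorm {E : Type*} [AddCommGroup E] [Module ℝ E] (𝒜 : Set E) : E → ℝ :=
  gauge (convexHull ℝ 𝒜)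

/-- The `(k,q)`-CUT norm. -/
noncomputable def cutNorm (m₁ m₂ k q : ℕ) : RMat m₁ m₂ → ℝ :=
  atomicNorm (cutAtoms m₁ m₂ k q)

section StatisticalDimension

variable {E : Type*} [NormedAddCommGroup E] [InnerProductSpace ℝ E]

/-- The tangent cone of `f` at `z`: the closure of the set of descent directions. -/
def descentCone (f : E → ℝ) (z : E) : Set E :=
  closure (⋃ τ : {τ : ℝ // 0 < τ}, {h : E | f (z + τ.1 • h) ≤ f z})

/-- `p` is a point of `K` nearest to `x`. -/
def IsNearest (K : Set E) (x p : E) : Prop :=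
  p ∈ K ∧ ∀ y ∈ K, ‖x - p‖ ≤ ‖x - y‖

/-- The orthogonal (metric) projection onto a non-empty closed convex set. -/
noncomputable def metricProj (K : Set E) (x : E) : E :=
  Classical.epsilon (IsNearest K x)

theorem isNearest_metricProj [FiniteDimensional ℝ E] {K : Set E} (hK : IsClosed K)
    (hne : K.Nonempty) (x : E) : IsNearest K x (metricProj K x) := by
  apply Classical.epsilon_spec (p := IsNearest K x)
  have : ProperSpace E := FiniteDimensional.proper ℝ E
  obtain ⟨p, hp, h⟩ := hK.exists_infDist_eq_dist hne x
  refine ⟨p, hp, fun y hy => ?_⟩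
  rw [← dist_eq_norm, ← dist_eq_norm, ← h]
  exact Metric.infDist_le_dist_of_mem hy

theorem IsNearest.unique {K : Set E} (hK : Convex ℝ K) {x p p' : E}
    (h : IsNearest K x p) (h' : IsNearest K x p') : p = p' := by
  have hm := h.2 _ (hK h.1 h'.1 (by norm_num : (0 : ℝ) ≤ 1 / 2)
    (by norm_num : (0 : ℝ) ≤ 1 / 2) (by norm_num))
  have he : ‖x - p‖ = ‖x - p'‖ := le_antisymm (h.2 _ h'.1) (h'.2 _ h.1)
  have hpar := parallelogram_law_with_norm ℝ (x - p) (x - p')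
  have h1 : x - p + (x - p') = (2 : ℝ) • (x - ((1 / 2 : ℝ) • p + (1 / 2 : ℝ) • p')) := by
    module
  rw [h1, norm_smul] at hpar
  have h2 : ‖x - p - (x - p')‖ = 0 := by
    have : ‖(2 : ℝ)‖ = 2 := by norm_num
    rw [this] at hpar
    nlinarith [norm_nonneg (x - p), norm_nonneg (x - p - (x - p'))]
  have h3 := norm_eq_zero.mp h2
  have h4 : p' - p = 0 := by rw [← h3]; abel
  exact (sub_eq_zero.mp h4).symm

variable [FiniteDimensional ℝ E] [MeasurableSpace E] [BorelSpace E]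

/-- `G ↦ ‖Π_T(G)‖²`, with `T` the tangent cone of `f` at `z`. -/
noncomputable def sqNormProj (f : E → ℝ) (z : E) (g : E) : ℝ :=
  ‖metricProj (descentCone f z) g‖ ^ 2

/-- The statistical dimension `𝔼 ‖Π_T(G)‖²` of `f` at `z`, where `G` is a standard Gaussian
vector of `E` (on `RMat m₁ m₂`: a matrix with i.i.d. standard normal entries, see
`ProbabilityTheory.map_pi_eq_stdGaussian`). -/
noncomputable def statDim (f : E → ℝ) (z : E) : ℝ :=
  ∫ g, sqNormProj f z g ∂(stdGaussian E)

end StatisticalDimension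

/-- A polytope whose group of isometric symmetries acts transitively on its vertices. -/
def IsVertexTransitivePolytope {E : Type*} [NormedAddCommGroup E] [InnerProductSpace ℝ E]
    (P : Set E) : Prop :=
  (∃ S : Set E, S.Finite ∧ P = convexHull ℝ S) ∧
    ∀ v ∈ extremePoints ℝ P, ∀ w ∈ extremePoints ℝ P,
      ∃ φ : E ≃ᵃⁱ[ℝ] E, φ '' P = P ∧ φ v = w

end SparseCut

/-! The standard Gaussian measure `γ` of a Euclidean space has Maurey's property (τ) with cost
`‖x - y‖² / 4`: on the line this is the Prékopa–Leindler inequality applied to the density, and the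
property tensorizes. Let `T` be the tangent cone of the gauge at an atom `v`, and let `N` be the
normal cone of the atoms at `v`. Every `y ∈ N` has non-positive inner product with every element of
`T`, hence `‖Π_T g‖ ≤ ‖g - y‖`, and property (τ) gives `𝔼 exp (‖Π_T g‖² / 4) * γ(N) ≤ 1`. By
Jensen's inequality the statistical dimension is at most `-4 log γ(N)`.

Signed permutations of the rows and columns are isometries acting transitively on the atoms, so the
normal cones at the atoms have the same measure; they cover the space, whence `γ(N) ≥ 1 / #atoms`
and the statistical dimension is at most `4 log #atoms`. All atoms have norm `1`, so all of them are
extreme points of their convex hull, and since `(a, b) ↦ a bᵀ` is two-to-one there are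
`2 ^ (k + q - 1) * (m₁ choose k) * (m₂ choose q)` of them.
-/

namespace SparseCut

open Set MeasureTheory ProbabilityTheory
open scoped ENNReal Pointwise

section PrekopaLeindler

theorem volume_add_volume_le_volume_add_of_isCompact {K L : Set ℝ} (hK : IsCompact K)
    (hL : IsCompact L) (hK₀ : K.Nonempty) (hL₀ : L.Nonempty) :
    volume K + volume L ≤ volume (K + L) := by
  obtain ⟨M, hMK, hM⟩ := hK.exists_isGreatest hK₀
  obtain ⟨N, hNL, hN⟩ := hL.exists_isLeast hL₀
  have hinter : (N +ᵥ K) ∩ (M +ᵥ L) ⊆ {N + M} := by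
    rintro _ ⟨⟨x, hx, rfl⟩, y, hy, hxy⟩
    have := hM hx
    have := hN hy
    simp only [vadd_eq_add, mem_singleton_iff] at hxy ⊢
    linarith
  have hsub : (N +ᵥ K) ∪ (M +ᵥ L) ⊆ K + L := by
    rintro _ (⟨x, hx, rfl⟩ | ⟨y, hy, rfl⟩)
    · exact ⟨x, hx, N, hNL, add_comm x N⟩
    · exact ⟨M, hMK, y, hy, rfl⟩
  calc volume K + volume L = volume (N +ᵥ K) + volume (M +ᵥ L) := by
        rw [measure_vadd, measure_vadd]
    _ = volume ((N +ᵥ K) ∪ (M +ᵥ L)) :=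
        (measure_union₀ (hL.vadd M).measurableSet.nullMeasurableSet
          (measure_mono_null hinter Real.volume_singleton)).symm
    _ ≤ volume (K + L) := measure_mono hsub

theorem volume_add_volume_le_volume_add {A B : Set ℝ} (hA : MeasurableSet A)
    (hB : MeasurableSet B) (hA₀ : A.Nonempty) (hB₀ : B.Nonempty) :
    volume A + volume B ≤ volume (A + B) := by
  obtain ⟨a, ha⟩ := hA₀
  obtain ⟨b, hb⟩ := hB₀
  rw [hA.measure_eq_iSup_isCompact, hB.measure_eq_iSup_isCompact]
  simp only [iSup_and']
  refine ENNReal.biSup_add_biSup_le' ⟨∅, empty_subset A, isCompact_empty⟩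
    ⟨∅, empty_subset B, isCompact_empty⟩ fun K ⟨hKA, hK⟩ L ⟨hLB, hL⟩ => ?_
  calc volume K + volume L ≤ volume (insert a K) + volume (insert b L) := by
        gcongr <;> exact subset_insert _ _
    _ ≤ volume (insert a K + insert b L) :=
        volume_add_volume_le_volume_add_of_isCompact (hK.insert a) (hL.insert b)
          (insert_nonempty a K) (insert_nonempty b L)
    _ ≤ volume (A + B) := by
        gcongr
        exacts [insert_subset ha hKA, insert_subset hb hLB]

theorem lintegral_eq_lintegral_measure_ofReal_lt {α : Type*} [MeasurableSpace α] {μ : Measure α}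
    [SFinite μ] {u : α → ℝ≥0∞} (hu : Measurable u) :
    ∫⁻ x, u x ∂μ = ∫⁻ t in Ioi (0 : ℝ), μ {x | ENNReal.ofReal t < u x} := by
  have hsection : ∀ c : ℝ≥0∞, volume.restrict (Ioi (0 : ℝ)) {t | ENNReal.ofReal t < c} = c := by
    intro c
    rw [Measure.restrict_apply (measurableSet_lt (by fun_prop) measurable_const)]
    rcases eq_or_ne c ∞ with rfl | hc
    · simp
    · have : {t | ENNReal.ofReal t < c} ∩ Ioi 0 = Ioo 0 c.toReal := by
        ext t
        simp only [mem_inter_iff, mem_ofPred_eq, mem_Ioi, mem_Ioo, and_comm (a := 0 < t)]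
        exact and_congr_left fun ht => ENNReal.ofReal_lt_iff_lt_toReal ht.le hc
      rw [this, Real.volume_Ioo, sub_zero, ENNReal.ofReal_toReal hc]
  have hS : MeasurableSet {p : α × ℝ | ENNReal.ofReal p.2 < u p.1} :=
    measurableSet_lt (by fun_prop) (by fun_prop)
  calc ∫⁻ x, u x ∂μ
      = ∫⁻ x, volume.restrict (Ioi (0 : ℝ)) {t | ENNReal.ofReal t < u x} ∂μ := by
        simp only [hsection]
    _ = μ.prod (volume.restrict (Ioi (0 : ℝ))) {p | ENNReal.ofReal p.2 < u p.1} :=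
        (Measure.prod_apply hS).symm
    _ = _ := Measure.prod_apply_symm hS

theorem lintegral_add_lintegral_le_of_iSup_eq_one {u v h : ℝ → ℝ≥0∞} (hu : Measurable u)
    (hv : Measurable v) (hh : Measurable h) (hu₁ : ⨆ x, u x = 1) (hv₁ : ⨆ x, v x = 1)
    (huv : ∀ x y, u x * v y ≤ h ((x + y) / 2) ^ 2) :
    (∫⁻ x, u x) + ∫⁻ x, v x ≤ 2 * ∫⁻ x, h x := by
  have hlevel : ∀ t : ℝ≥0∞, volume {x | t < u x} + volume {x | t < v x} ≤
      2 * volume {x | t < h x} := by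
    intro t
    rcases lt_or_ge t 1 with ht | ht
    · have hsub : {x | t < u x} + {x | t < v x} ⊆ (2 : ℝ) • {x | t < h x} := by
        rintro _ ⟨x, hx, y, hy, rfl⟩
        have hsq : t ^ 2 < h ((x + y) / 2) ^ 2 :=
          (sq t ▸ ENNReal.mul_lt_mul hx hy).trans_le (huv x y)
        exact ⟨(x + y) / 2, lt_of_not_ge fun hle => hsq.not_ge (pow_le_pow_left' hle 2),
          mul_div_cancel₀ _ two_ne_zero⟩
      have hne : ∀ w : ℝ → ℝ≥0∞, ⨆ x, w x = 1 → {x | t < w x}.Nonempty := fun w hw =>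
        let ⟨x, hx⟩ := lt_iSup_iff.1 (hw ▸ ht)
        ⟨x, hx⟩
      calc volume {x | t < u x} + volume {x | t < v x}
          ≤ volume ({x | t < u x} + {x | t < v x}) :=
            volume_add_volume_le_volume_add (measurableSet_lt measurable_const hu)
              (measurableSet_lt measurable_const hv) (hne u hu₁) (hne v hv₁)
        _ ≤ volume ((2 : ℝ) • {x | t < h x}) := measure_mono hsub
        _ = 2 * volume {x | t < h x} := by simp [Measure.addHaar_smul]
    · have hempty : ∀ w : ℝ → ℝ≥0∞, ⨆ x, w x = 1 → {x | t < w x} = ∅ := fun w hw =>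
        eq_empty_of_forall_notMem fun x hx =>
          (ht.trans_lt (lt_of_lt_of_le hx (le_iSup w x))).ne' hw
      simp [hempty u hu₁, hempty v hv₁]
  have hmeas : Measurable fun t : ℝ => volume {x | ENNReal.ofReal t < u x} :=
    Antitone.measurable fun s t hst => measure_mono fun x hx =>
      (ENNReal.ofReal_le_ofReal hst).trans_lt hx
  rw [lintegral_eq_lintegral_measure_ofReal_lt hu, lintegral_eq_lintegral_measure_ofReal_lt hv,
    lintegral_eq_lintegral_measure_ofReal_lt hh, ← lintegral_add_left hmeas,
    ← lintegral_const_mul' _ _ ENNReal.ofNat_ne_top]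
  exact lintegral_mono fun t => hlevel _

theorem ennreal_mul_le_sq_of_add_le_two_mul {a b c : ℝ≥0∞} (h : a + b ≤ 2 * c) :
    a * b ≤ c ^ 2 := by
  rcases eq_or_ne c ∞ with rfl | hc
  · simp
  have hab : a + b ≠ ∞ := ne_top_of_le_ne_top (by finiteness) h
  lift c to NNReal using hc
  lift a to NNReal using (ENNReal.add_ne_top.1 hab).1
  lift b to NNReal using (ENNReal.add_ne_top.1 hab).2
  norm_cast at h ⊢
  have hsq : 4 * (a * b) ≤ 4 * c ^ 2 :=
    calc 4 * (a * b) = 4 * a * b := (mul_assoc 4 a b).symm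
      _ ≤ (a + b) ^ 2 := four_mul_le_sq_add a b
      _ ≤ (2 * c) ^ 2 := by gcongr
      _ = 4 * c ^ 2 := by ring
  exact le_of_mul_le_mul_left hsq four_pos

theorem lintegral_mul_lintegral_le_of_iSup_ne_top {u v h : ℝ → ℝ≥0∞} (hu : Measurable u)
    (hv : Measurable v) (hh : Measurable h) (hu_top : ⨆ x, u x ≠ ∞) (hv_top : ⨆ x, v x ≠ ∞)
    (huv : ∀ x y, u x * v y ≤ h ((x + y) / 2) ^ 2) :
    (∫⁻ x, u x) * ∫⁻ x, v x ≤ (∫⁻ x, h x) ^ 2 := by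
  set a := ⨆ x, u x with ha
  set b := ⨆ x, v x with hb
  rcases eq_or_ne a 0 with ha₀ | ha₀
  · simp [ENNReal.iSup_eq_zero.1 ha₀]
  rcases eq_or_ne b 0 with hb₀ | hb₀
  · simp [ENNReal.iSup_eq_zero.1 hb₀]
  obtain ⟨c, hc⟩ : ∃ c : ℝ≥0∞, c ^ 2 = a⁻¹ * b⁻¹ :=
    ⟨(a⁻¹ * b⁻¹) ^ (2⁻¹ : ℝ), by rw [← ENNReal.rpow_natCast, ← ENNReal.rpow_mul]; simp⟩
  have hnormalized := lintegral_add_lintegral_le_of_iSup_eq_one (hu.const_mul a⁻¹)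
    (hv.const_mul b⁻¹) (hh.const_mul c)
    (by rw [← ENNReal.mul_iSup, ← ha, ENNReal.inv_mul_cancel ha₀ hu_top])
    (by rw [← ENNReal.mul_iSup, ← hb, ENNReal.inv_mul_cancel hb₀ hv_top]) fun x y => by
      rw [mul_pow, hc, mul_mul_mul_comm]
      gcongr
      exact huv x y
  rw [lintegral_const_mul _ hu, lintegral_const_mul _ hv, lintegral_const_mul _ hh] at hnormalized
  have := ennreal_mul_le_sq_of_add_le_two_mul hnormalized
  rw [mul_pow, hc, mul_mul_mul_comm] at this
  refine (ENNReal.mul_le_mul_iff_right ?_ ?_).1 this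
  · simp [hu_top, hv_top]
  · exact ENNReal.mul_ne_top (ENNReal.inv_ne_top.2 ha₀) (ENNReal.inv_ne_top.2 hb₀)

theorem prekopa_leindler_real {u v h : ℝ → ℝ≥0∞} (hu : Measurable u)
    (hv : Measurable v) (hh : Measurable h) (huv : ∀ x y, u x * v y ≤ h ((x + y) / 2) ^ 2) :
    (∫⁻ x, u x) * ∫⁻ x, v x ≤ (∫⁻ x, h x) ^ 2 := by
  have htrunc : ∀ w : ℝ → ℝ≥0∞, Measurable w →
      ∫⁻ x, w x = ⨆ n : ℕ, ∫⁻ x, min (w x) n := by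
    intro w hw
    rw [← lintegral_iSup (fun n => hw.min measurable_const)
      fun m n hmn x => min_le_min_left _ (by exact_mod_cast hmn)]
    congr with x
    rw [← inf_iSup_eq]
    simp [ENNReal.iSup_natCast]
  have hbdd : ∀ (w : ℝ → ℝ≥0∞) (n : ℕ), ⨆ x, min (w x) n ≠ ∞ := fun w n =>
    ne_top_of_le_ne_top (ENNReal.natCast_ne_top n) (iSup_le fun x => min_le_right _ _)
  rw [htrunc u hu, htrunc v hv, ENNReal.iSup_mul]
  refine iSup_le fun n => ?_
  rw [ENNReal.mul_iSup]
  refine iSup_le fun m => ?_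
  refine lintegral_mul_lintegral_le_of_iSup_ne_top (hu.min measurable_const)
    (hv.min measurable_const) hh (hbdd u n) (hbdd v m) fun x y => ?_
  exact (mul_le_mul' (min_le_left _ _) (min_le_left _ _)).trans (huv x y)

end PrekopaLeindler

section PropertyTau

variable {X Y : Type*} [MeasurableSpace X] [MeasurableSpace Y]

/-- Maurey's property (τ) of a measure with respect to a transport cost `c`. Quantifying over all
pairs `f, g` with `f x * g y ≤ exp (c x y)`, rather than over `f` and its infimal convolution with
`c`, avoids measurability issues. -/
def HasPropertyTau (μ : Measure X) (c : X → X → ℝ) : Prop :=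
  ∀ f g : X → ℝ≥0∞, Measurable f → Measurable g →
    (∀ x y, f x * g y ≤ ENNReal.ofReal (Real.exp (c x y))) → (∫⁻ x, f x ∂μ) * ∫⁻ x, g x ∂μ ≤ 1

theorem HasPropertyTau.map {μ : Measure X} {c : X → X → ℝ} (hμ : HasPropertyTau μ c) {φ : X → Y}
    (hφ : Measurable φ) {d : Y → Y → ℝ} (hd : ∀ x y, d (φ x) (φ y) ≤ c x y) :
    HasPropertyTau (μ.map φ) d := by
  intro f g hf hg hfg
  rw [lintegral_map hf hφ, lintegral_map hg hφ]
  exact hμ _ _ (hf.comp hφ) (hg.comp hφ) fun x y => (hfg _ _).trans (by gcongr; exact hd x y)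

theorem HasPropertyTau.prod {μ : Measure X} {ν : Measure Y} [SFinite ν] {c : X → X → ℝ}
    {d : Y → Y → ℝ} (hμ : HasPropertyTau μ c) (hν : HasPropertyTau ν d) :
    HasPropertyTau (μ.prod ν) fun p q => c p.1 q.1 + d p.2 q.2 := by
  intro f g hf hg hfg
  rw [lintegral_prod _ hf.aemeasurable, lintegral_prod _ hg.aemeasurable]
  refine hμ _ _ hf.lintegral_prod_right' hg.lintegral_prod_right' fun x x' => ?_
  set e := ENNReal.ofReal (Real.exp (c x x')) with he
  have he₀ : e ≠ 0 := by simp [he, Real.exp_pos]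
  have he_top : e ≠ ∞ := ENNReal.ofReal_ne_top
  have hsection := hν (fun y => e⁻¹ * f (x, y)) (fun y => g (x', y)) (by fun_prop) (by fun_prop)
    fun y y' => by
      rw [mul_assoc, ENNReal.inv_mul_le_iff he₀ he_top, he, ← ENNReal.ofReal_mul (by positivity),
        ← Real.exp_add]
      exact hfg (x, y) (x', y')
  rwa [lintegral_const_mul _ (by fun_prop), mul_assoc, ENNReal.inv_mul_le_iff he₀ he_top,
    mul_one] at hsection

theorem HasPropertyTau.pi {n : ℕ} {X : Fin n → Type*} [∀ i, MeasurableSpace (X i)]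
    {μ : ∀ i, Measure (X i)} [∀ i, IsProbabilityMeasure (μ i)] {c : ∀ i, X i → X i → ℝ}
    (hμ : ∀ i, HasPropertyTau (μ i) (c i)) :
    HasPropertyTau (Measure.pi μ) fun x y => ∑ i, c i (x i) (y i) := by
  induction n with
  | zero =>
    intro f g _ _ hfg
    simpa [Measure.pi_of_empty _ isEmptyElim] using hfg isEmptyElim isEmptyElim
  | succ n ih =>
    rw [← (measurePreserving_piFinSuccAbove μ 0).symm.map_eq]
    refine ((hμ 0).prod (ih fun i => hμ ((0 : Fin (n + 1)).succAbove i))).map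
      (MeasurableEquiv.measurable _) fun x y => ?_
    simp only [Fin.sum_univ_succAbove _ 0, MeasurableEquiv.piFinSuccAbove_symm_apply,
      Fin.insertNthEquiv_apply, Fin.insertNth_apply_same, Fin.insertNth_apply_succAbove, le_refl]

theorem gaussianPDF_mul_gaussianPDF_mul_exp (m : ℝ) (v : NNReal) (x y : ℝ) :
    gaussianPDF m v x * gaussianPDF m v y * ENNReal.ofReal (Real.exp ((x - y) ^ 2 / (4 * v))) =
      gaussianPDF m v ((x + y) / 2) ^ 2 := by
  simp only [gaussianPDF]
  rw [← ENNReal.ofReal_mul (gaussianPDFReal_nonneg _ _ _),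
    ← ENNReal.ofReal_mul (mul_nonneg (gaussianPDFReal_nonneg _ _ _) (gaussianPDFReal_nonneg _ _ _)),
    ← ENNReal.ofReal_pow (gaussianPDFReal_nonneg _ _ _)]
  simp only [gaussianPDFReal]
  rw [mul_mul_mul_comm, ← Real.exp_add, mul_assoc _ (Real.exp _), ← Real.exp_add, mul_pow,
    ← Real.exp_nat_mul, ← sq]
  congr 2
  rw [Real.exp_eq_exp]
  push_cast
  ring

theorem hasPropertyTau_gaussianReal (m : ℝ) {v : NNReal} (hv : v ≠ 0) :
    HasPropertyTau (gaussianReal m v) fun x y => (x - y) ^ 2 / (4 * v) := by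
  intro f g hf hg hfg
  have hpdf : Measurable (gaussianPDF m v) := measurable_gaussianPDF m v
  rw [gaussianReal_of_var_ne_zero m hv, lintegral_withDensity_eq_lintegral_mul _ hpdf hf,
    lintegral_withDensity_eq_lintegral_mul _ hpdf hg]
  calc (∫⁻ x, (gaussianPDF m v * f) x) * ∫⁻ x, (gaussianPDF m v * g) x
      ≤ (∫⁻ x, gaussianPDF m v x) ^ 2 := by
        refine prekopa_leindler_real (hpdf.mul hf) (hpdf.mul hg) hpdf fun x y => ?_
        rw [← gaussianPDF_mul_gaussianPDF_mul_exp m v, Pi.mul_apply, Pi.mul_apply,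
          mul_mul_mul_comm]
        gcongr
        exact hfg x y
    _ = 1 := by rw [lintegral_gaussianPDF_eq_one m hv, one_pow]

theorem hasPropertyTau_stdGaussian (E : Type*) [NormedAddCommGroup E] [InnerProductSpace ℝ E]
    [FiniteDimensional ℝ E] [MeasurableSpace E] [BorelSpace E] :
    HasPropertyTau (stdGaussian E) fun x y => ‖x - y‖ ^ 2 / 4 := by
  have htensor := HasPropertyTau.pi fun _ : Fin (Module.finrank ℝ E) =>
    hasPropertyTau_gaussianReal 0 one_ne_zero
  refine htensor.map (by fun_prop) fun x y => le_of_eq ?_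
  have hnorm : ‖∑ i, (x i - y i) • stdOrthonormalBasis ℝ E i‖ ^ 2 = ∑ i, (x i - y i) ^ 2 := by
    rw [← real_inner_self_eq_norm_sq, (stdOrthonormalBasis ℝ E).orthonormal.inner_sum]
    simp [sq]
  simp only [← Finset.sum_sub_distrib, ← sub_smul, hnorm, NNReal.coe_one, mul_one, Finset.sum_div]

theorem HasPropertyTau.integral_le_neg_log {μ : Measure X} [IsProbabilityMeasure μ]
    {c : X → X → ℝ} (hμ : HasPropertyTau μ c) {h : X → ℝ} (hh : Measurable h)
    (hint : Integrable h μ) {K : Set X} (hK : MeasurableSet K) (hK₀ : μ K ≠ 0)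
    (hc : ∀ x, ∀ y ∈ K, h x ≤ c x y) :
    ∫ x, h x ∂μ ≤ -Real.log (μ.real K) := by
  have hexp : (∫⁻ x, ENNReal.ofReal (Real.exp (h x)) ∂μ) * μ K ≤ 1 := by
    rw [← lintegral_indicator_one hK]
    refine hμ _ _ (by fun_prop) (measurable_one.indicator hK) fun x y => ?_
    by_cases hy : y ∈ K
    · simpa [hy] using ENNReal.ofReal_le_ofReal (Real.exp_le_exp.2 (hc x y hy))
    · simp [hy]
  have hexp_int : Integrable (fun x => Real.exp (h x)) μ := by
    refine ⟨by fun_prop, ?_⟩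
    rw [hasFiniteIntegral_iff_ofReal (ae_of_all _ fun x => (Real.exp_pos _).le)]
    exact lt_top_iff_ne_top.2 fun htop => by simp [htop, hK₀] at hexp
  have hjensen : Real.exp (∫ x, h x ∂μ) ≤ ∫ x, Real.exp (h x) ∂μ :=
    convexOn_exp.map_integral_le Real.continuous_exp.continuousOn isClosed_univ (by simp) hint
      hexp_int
  have hK_pos : 0 < μ.real K := ENNReal.toReal_pos hK₀ (measure_ne_top μ K)
  have hexp_real : (∫ x, Real.exp (h x) ∂μ) * μ.real K ≤ 1 := by
    rw [integral_eq_lintegral_of_nonneg_ae (ae_of_all _ fun x => (Real.exp_pos _).le) (by fun_prop),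
      Measure.real, ← ENNReal.toReal_mul]
    exact ENNReal.toReal_mono ENNReal.one_ne_top hexp
  rw [← Real.log_inv, Real.le_log_iff_exp_le (inv_pos.2 hK_pos)]
  exact hjensen.trans (by rwa [← one_div, le_div_iff₀ hK_pos])

end PropertyTau

section NearestPoint

variable {E : Type*} [NormedAddCommGroup E] {K : Set E} {g p : E}

theorem IsNearest.norm_sub_eq_infDist (h : IsNearest K g p) : ‖g - p‖ = Metric.infDist g K := by
  rw [← dist_eq_norm]
  refine le_antisymm ((Metric.le_infDist ⟨p, h.1⟩).2 fun {y} hy => ?_)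
    (Metric.infDist_le_dist_of_mem h.1)
  simpa only [dist_eq_norm] using h.2 y hy

variable [InnerProductSpace ℝ E]

theorem IsNearest.inner_sub_eq_zero (h : IsNearest K g p) (hK : ∀ t : ℝ, 0 ≤ t → t • p ∈ K) :
    inner ℝ p (g - p) = 0 := by
  have hmin : IsLocalMin (fun t : ℝ => ‖g - t • p‖ ^ 2) 1 := by
    filter_upwards [lt_mem_nhds one_pos] with t ht
    gcongr
    simpa using h.2 _ (hK t ht.le)
  have hderiv : HasDerivAt (fun t : ℝ => ‖g - t • p‖ ^ 2)
      (2 * inner ℝ (g - (1 : ℝ) • p) (-p)) 1 := by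
    simpa using (((hasDerivAt_id (1 : ℝ)).smul_const p).const_sub g).norm_sq
  simpa [real_inner_comm] using hmin.hasDerivAt_eq_zero hderiv

theorem IsNearest.norm_sq_eq (h : IsNearest K g p) (hK : ∀ t : ℝ, 0 ≤ t → t • p ∈ K) :
    ‖p‖ ^ 2 = ‖g‖ ^ 2 - Metric.infDist g K ^ 2 := by
  have hpythagoras := norm_add_sq_real p (g - p)
  rw [add_sub_cancel, h.inner_sub_eq_zero hK] at hpythagoras
  rw [hpythagoras, ← h.norm_sub_eq_infDist]
  ring

theorem IsNearest.norm_le_norm_sub (h : IsNearest K g p) (hK : ∀ t : ℝ, 0 ≤ t → t • p ∈ K) {y : E}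
    (hy : inner ℝ p y ≤ 0) : ‖p‖ ≤ ‖g - y‖ := by
  rcases eq_or_ne p 0 with rfl | hp
  · simp
  refine le_of_mul_le_mul_left ?_ (norm_pos_iff.2 hp)
  calc ‖p‖ * ‖p‖ = inner ℝ p g := by
        rw [← real_inner_self_eq_norm_mul_norm, eq_comm, ← sub_eq_zero, ← inner_sub_right,
          h.inner_sub_eq_zero hK]
    _ ≤ inner ℝ p (g - y) := by rw [inner_sub_right]; linarith
    _ ≤ ‖p‖ * ‖g - y‖ := real_inner_le_norm p (g - y)

end NearestPoint

section NormalCone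

variable {E : Type*} [NormedAddCommGroup E] [InnerProductSpace ℝ E]

/-- The normal cone of `S` at `v`: the linear functionals, identified with vectors, that are
maximised over `S` at `v`. The point `v` is not required to lie in `S`. -/
def normalCone (S : Set E) (v : E) : Set E :=
  {y | ∀ x ∈ S, inner ℝ x y ≤ inner ℝ v y}

theorem isClosed_normalCone (S : Set E) (v : E) : IsClosed (normalCone S v) := by
  simp only [normalCone, ofPred_forall]
  exact isClosed_biInter fun x _ => isClosed_le (by fun_prop) (by fun_prop)

theorem normalCone_convexHull (S : Set E) (v : E) :
    normalCone (convexHull ℝ S) v = normalCone S v := by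
  refine subset_antisymm (fun y hy x hx => hy x (subset_convexHull ℝ S hx)) fun y hy => ?_
  have hconvex : Convex ℝ {x : E | inner ℝ x y ≤ inner ℝ v y} :=
    convex_halfSpace_le ⟨fun _ _ => inner_add_left _ _ _,
      fun _ _ => real_inner_smul_left _ _ _⟩ _
  exact convexHull_min hy hconvex

theorem preimage_normalCone_image {F : Type*} [NormedAddCommGroup F] [InnerProductSpace ℝ F]
    (φ : E ≃ₗᵢ[ℝ] F) (S : Set E) (v : E) :
    φ ⁻¹' normalCone (φ '' S) (φ v) = normalCone S v := by
  ext y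
  simp [normalCone]

theorem iUnion_normalCone_eq_univ {S : Set E} (hS : S.Finite) (hne : S.Nonempty) :
    ⋃ v ∈ S, normalCone S v = univ := by
  refine eq_univ_of_forall fun y => ?_
  obtain ⟨v, hv, hmax⟩ := exists_max_image S (fun x => inner ℝ x y) hS hne
  exact mem_biUnion hv hmax

end NormalCone

section DescentCone

variable {E : Type*} [NormedAddCommGroup E] [InnerProductSpace ℝ E] {f : E → ℝ} {z : E}

theorem zero_mem_descentCone (f : E → ℝ) (z : E) : (0 : E) ∈ descentCone f z :=
  subset_closure <| mem_iUnion.2 ⟨⟨1, one_pos⟩, by simp⟩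

theorem smul_mem_descentCone {h : E} (hh : h ∈ descentCone f z) {t : ℝ} (ht : 0 ≤ t) :
    t • h ∈ descentCone f z := by
  rcases ht.eq_or_lt with rfl | ht
  · simpa using zero_mem_descentCone f z
  refine map_mem_closure (continuous_const_smul t) hh fun x hx => ?_
  obtain ⟨⟨τ, hτ⟩, hx⟩ := mem_iUnion.1 hx
  refine mem_iUnion.2 ⟨⟨τ / t, div_pos hτ ht⟩, ?_⟩
  simpa only [mem_ofPred_eq, smul_smul, div_mul_cancel₀ _ ht.ne'] using hx

theorem inner_nonpos_of_mem_descentCone {h y : E} (hh : h ∈ descentCone f z)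
    (hy : y ∈ normalCone {x | f x ≤ f z} z) : inner ℝ h y ≤ 0 := by
  have hclosed : IsClosed {h : E | inner ℝ h y ≤ 0} := isClosed_le (by fun_prop) continuous_const
  refine closure_minimal (fun x hx => ?_) hclosed hh
  obtain ⟨⟨τ, hτ⟩, hx⟩ := mem_iUnion.1 hx
  have := hy _ hx
  rw [inner_add_left, real_inner_smul_left] at this
  exact nonpos_of_mul_nonpos_right (by linarith) hτ

variable [FiniteDimensional ℝ E]

theorem isNearest_metricProj_descentCone (f : E → ℝ) (z g : E) :
    IsNearest (descentCone f z) g (metricProj (descentCone f z) g) :=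
  isNearest_metricProj isClosed_closure ⟨0, zero_mem_descentCone f z⟩ g

theorem smul_metricProj_descentCone_mem (f : E → ℝ) (z g : E) (t : ℝ) (ht : 0 ≤ t) :
    t • metricProj (descentCone f z) g ∈ descentCone f z :=
  smul_mem_descentCone (isNearest_metricProj_descentCone f z g).1 ht

theorem norm_metricProj_descentCone_le {y : E} (hy : y ∈ normalCone {x | f x ≤ f z} z) (g : E) :
    ‖metricProj (descentCone f z) g‖ ≤ ‖g - y‖ :=
  have hproj := isNearest_metricProj_descentCone f z g
  hproj.norm_le_norm_sub (smul_metricProj_descentCone_mem f z g)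
    (inner_nonpos_of_mem_descentCone hproj.1 hy)

theorem continuous_sqNormProj (f : E → ℝ) (z : E) : Continuous (sqNormProj f z) := by
  have heq : sqNormProj f z = fun g => ‖g‖ ^ 2 - Metric.infDist g (descentCone f z) ^ 2 :=
    funext fun g => (isNearest_metricProj_descentCone f z g).norm_sq_eq
      (smul_metricProj_descentCone_mem f z g)
  have := Metric.continuous_infDist_pt (descentCone f z)
  rw [heq]
  fun_prop

variable [MeasurableSpace E] [BorelSpace E]

theorem integrable_sqNormProj (f : E → ℝ) (z : E) :
    Integrable (sqNormProj f z) (stdGaussian E) := by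
  have hnorm : Integrable (fun g : E => ‖g‖ ^ 2) (stdGaussian E) :=
    (IsGaussian.memLp_two_id (μ := stdGaussian E)).integrable_norm_pow two_ne_zero
  refine hnorm.mono' (continuous_sqNormProj f z).aestronglyMeasurable (ae_of_all _ fun g => ?_)
  rw [sqNormProj, Real.norm_of_nonneg (sq_nonneg _)]
  gcongr
  simpa using norm_metricProj_descentCone_le (f := f) (z := z) (y := 0) (by simp [normalCone]) g

theorem statDim_le_neg_four_mul_log {S : Set E} (hS : {x | f x ≤ f z} ⊆ S)
    (hpos : 0 < (stdGaussian E).real (normalCone S z)) :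
    statDim f z ≤ -(4 * Real.log ((stdGaussian E).real (normalCone S z))) := by
  have htau : ∫ g, sqNormProj f z g / 4 ∂stdGaussian E ≤
      -Real.log ((stdGaussian E).real (normalCone S z)) := by
    refine (hasPropertyTau_stdGaussian E).integral_le_neg_log
      ((continuous_sqNormProj f z).measurable.div_const 4)
      ((integrable_sqNormProj f z).div_const 4) (isClosed_normalCone S z).measurableSet
      ((measureReal_ne_zero_iff (measure_ne_top _ _)).1 hpos.ne') fun g y hy => ?_
    rw [sqNormProj]
    gcongr
    exact norm_metricProj_descentCone_le (fun x hx => hy x (hS hx)) g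
  rw [integral_div] at htau
  rw [statDim]
  linarith

end DescentCone

section Polytope

theorem setOf_atomicNorm_le_one {E : Type*} [AddCommGroup E] [Module ℝ E] [TopologicalSpace E]
    [IsTopologicalAddGroup E] [ContinuousSMul ℝ E] [T2Space E] {𝒜 : Set E} (hfin : 𝒜.Finite)
    (hnhds : convexHull ℝ 𝒜 ∈ nhds 0) : {x | atomicNorm 𝒜 x ≤ 1} = convexHull ℝ 𝒜 := by
  ext x
  rw [mem_ofPred_eq, atomicNorm, gauge_le_one_iff_mem_closure (convex_convexHull ℝ 𝒜) hnhds,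
    (hfin.isClosed_convexHull ℝ).closure_eq]

theorem extremePoints_convexHull_eq_of_norm_eq {E : Type*} [NormedAddCommGroup E]
    [NormedSpace ℝ E] [StrictConvexSpace ℝ E] {𝒜 : Set E} {r : ℝ} (hr : r ≠ 0)
    (h𝒜 : ∀ x ∈ 𝒜, ‖x‖ = r) : extremePoints ℝ (convexHull ℝ 𝒜) = 𝒜 := by
  refine subset_antisymm extremePoints_convexHull_subset fun x hx => ?_
  have hsub : convexHull ℝ 𝒜 ⊆ Metric.closedBall 0 r :=
    convexHull_min (fun y hy => by simp [h𝒜 y hy]) (convex_closedBall _ _)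
  exact inter_extremePoints_subset_extremePoints_of_subset hsub
    ⟨subset_convexHull ℝ _ hx, StrictConvexSpace.sphere_subset_extremePoints_closedBall 0 hr
      (mem_sphere_zero_iff_norm.2 (h𝒜 x hx))⟩

theorem convexHull_mem_nhds_zero {E : Type*} [NormedAddCommGroup E] [NormedSpace ℝ E]
    [FiniteDimensional ℝ E] {𝒜 : Set E} (hne : 𝒜.Nonempty) (hneg : ∀ x ∈ 𝒜, -x ∈ 𝒜)
    (hspan : Submodule.span ℝ 𝒜 = ⊤) : convexHull ℝ 𝒜 ∈ nhds 0 := by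
  obtain ⟨a, ha⟩ := hne
  have hneg_hull : ∀ x ∈ convexHull ℝ 𝒜, -x ∈ convexHull ℝ 𝒜 := fun x hx => by
    rw [← mem_neg, ← convexHull_neg]
    exact convexHull_mono hneg hx
  have hzero : (0 : E) ∈ convexHull ℝ 𝒜 := by
    have ha' := subset_convexHull ℝ 𝒜 ha
    simpa using (convex_convexHull ℝ 𝒜).midpoint_mem ha' (hneg_hull a ha')
  have haffine : affineSpan ℝ 𝒜 = ⊤ := by
    refine eq_top_iff.2 fun x _ => ?_
    have hx : x ∈ affineSpan ℝ (insert 0 𝒜) := by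
      rw [← SetLike.mem_coe, affineSpan_insert_zero, hspan]
      trivial
    rw [← affineSpan_convexHull]
    exact affineSpan_mono ℝ (insert_subset hzero (subset_convexHull ℝ 𝒜)) hx
  obtain ⟨x, hx⟩ := interior_convexHull_nonempty_iff_affineSpan_eq_top.2 haffine
  have hx' : -x ∈ convexHull ℝ 𝒜 := hneg_hull x (interior_subset hx)
  rw [← mem_interior_iff_mem_nhds]
  simpa using (convex_convexHull ℝ 𝒜).combo_interior_self_mem_interior hx hx'
    (one_half_pos (α := ℝ)) one_half_pos.le (add_halves 1)

end Polytope

section IsometryTransitive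

variable {E : Type*} [NormedAddCommGroup E] [InnerProductSpace ℝ E] {𝒜 : Set E} {v : E}

/-- A set on which the linear isometries of the ambient space preserving it act transitively. -/
def IsIsometryTransitive (𝒜 : Set E) : Prop :=
  ∀ v ∈ 𝒜, ∀ w ∈ 𝒜, ∃ φ : E ≃ₗᵢ[ℝ] E, φ '' 𝒜 = 𝒜 ∧ φ v = w

theorem IsIsometryTransitive.isVertexTransitivePolytope (h𝒜 : IsIsometryTransitive 𝒜)
    (hfin : 𝒜.Finite) : IsVertexTransitivePolytope (convexHull ℝ 𝒜) := by
  refine ⟨⟨𝒜, hfin, rfl⟩, fun v hv w hw => ?_⟩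
  obtain ⟨φ, hφ, hφv⟩ := h𝒜 v (extremePoints_convexHull_subset hv) w
    (extremePoints_convexHull_subset hw)
  refine ⟨φ.toAffineIsometryEquiv, ?_, hφv⟩
  calc φ '' convexHull ℝ 𝒜 = convexHull ℝ (φ '' 𝒜) :=
        φ.toLinearEquiv.toLinearMap.image_convexHull 𝒜
    _ = convexHull ℝ 𝒜 := by rw [hφ]

variable [FiniteDimensional ℝ E] [MeasurableSpace E] [BorelSpace E]

theorem IsIsometryTransitive.stdGaussian_normalCone_eq (h𝒜 : IsIsometryTransitive 𝒜) {w : E}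
    (hv : v ∈ 𝒜) (hw : w ∈ 𝒜) :
    (stdGaussian E).real (normalCone 𝒜 w) = (stdGaussian E).real (normalCone 𝒜 v) := by
  obtain ⟨φ, hφ, rfl⟩ := h𝒜 v hv w hw
  calc (stdGaussian E).real (normalCone 𝒜 (φ v))
      = ((stdGaussian E).map φ).real (normalCone (φ '' 𝒜) (φ v)) := by rw [stdGaussian_map, hφ]
    _ = (stdGaussian E).real (φ ⁻¹' normalCone (φ '' 𝒜) (φ v)) :=
        map_measureReal_apply φ.continuous.measurable (isClosed_normalCone _ _).measurableSet
    _ = (stdGaussian E).real (normalCone 𝒜 v) := by rw [preimage_normalCone_image]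

theorem IsIsometryTransitive.one_le_ncard_mul_stdGaussian_normalCone
    (h𝒜 : IsIsometryTransitive 𝒜) (hfin : 𝒜.Finite) (hv : v ∈ 𝒜) :
    1 ≤ 𝒜.ncard * (stdGaussian E).real (normalCone 𝒜 v) :=
  calc 1 = (stdGaussian E).real (⋃ w ∈ hfin.toFinset, normalCone 𝒜 w) := by
        simp [iUnion_normalCone_eq_univ hfin ⟨v, hv⟩]
    _ ≤ ∑ w ∈ hfin.toFinset, (stdGaussian E).real (normalCone 𝒜 w) :=
        measureReal_biUnion_finset_le _ _
    _ = 𝒜.ncard * (stdGaussian E).real (normalCone 𝒜 v) := by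
        rw [Finset.sum_congr rfl fun w hw =>
          h𝒜.stdGaussian_normalCone_eq hv (hfin.mem_toFinset.1 hw), Finset.sum_const, nsmul_eq_mul,
          ncard_eq_toFinset_card 𝒜 hfin]

theorem IsIsometryTransitive.statDim_atomicNorm_le (h𝒜 : IsIsometryTransitive 𝒜)
    (hfin : 𝒜.Finite) (hnhds : convexHull ℝ 𝒜 ∈ nhds 0) (hv : v ∈ 𝒜) :
    statDim (atomicNorm 𝒜) v ≤ 4 * Real.log 𝒜.ncard := by
  have hsublevel : {x | atomicNorm 𝒜 x ≤ atomicNorm 𝒜 v} ⊆ convexHull ℝ 𝒜 := by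
    rw [← setOf_atomicNorm_le_one hfin hnhds]
    exact fun x hx => le_trans hx (gauge_le_one_of_mem (subset_convexHull ℝ 𝒜 hv))
  have hcone := h𝒜.one_le_ncard_mul_stdGaussian_normalCone hfin hv
  rw [← normalCone_convexHull] at hcone
  have hpos : 0 < (stdGaussian E).real (normalCone (convexHull ℝ 𝒜) v) :=
    pos_of_mul_pos_right (one_pos.trans_le hcone) (Nat.cast_nonneg _)
  calc statDim (atomicNorm 𝒜) v
      ≤ -(4 * Real.log ((stdGaussian E).real (normalCone (convexHull ℝ 𝒜) v))) :=
        statDim_le_neg_four_mul_log hsublevel hpos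
    _ = 4 * Real.log ((stdGaussian E).real (normalCone (convexHull ℝ 𝒜) v))⁻¹ := by
        rw [Real.log_inv, mul_neg]
    _ ≤ 4 * Real.log 𝒜.ncard := by
        gcongr
        rwa [inv_le_iff_one_le_mul₀ hpos]

end IsometryTransitive

section SignedPermutation

variable {ι : Type*} [Fintype ι]

/-- The signed permutation `x ↦ (i ↦ ε i * x (σ i))` of the coordinates, as a linear isometry. -/
noncomputable def signedPerm (σ : Equiv.Perm ι) (ε : ι → ℤˣ) :
    EuclideanSpace ℝ ι ≃ₗᵢ[ℝ] EuclideanSpace ℝ ι :=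
  (LinearIsometryEquiv.piLpCongrLeft 2 ℝ ℝ σ.symm).trans
    (LinearIsometryEquiv.piLpCongrRight 2 fun i =>
      if ε i = 1 then LinearIsometryEquiv.refl ℝ ℝ else LinearIsometryEquiv.neg ℝ)

theorem signedPerm_apply (σ : Equiv.Perm ι) (ε : ι → ℤˣ) (x : EuclideanSpace ℝ ι) (i : ι) :
    signedPerm σ ε x i = (ε i : ℤ) * x (σ i) := by
  rcases Int.units_eq_one_or (ε i) with h | h <;>
    simp [signedPerm, h, LinearIsometryEquiv.piLpCongrLeft_apply, Equiv.piCongrLeft'_apply]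

end SignedPermutation

section FlatVec

variable {m k : ℕ} {a b : Fin m → ℝ}

theorem sum_sq_of_mem_flatVec (hk : 1 ≤ k) (ha : a ∈ flatVec m k) : ∑ i, a i ^ 2 = 1 := by
  have hk0 : (k : ℝ) ≠ 0 := by positivity
  have hsq : ∀ i, a i ^ 2 = if a i ≠ 0 then 1 / (k : ℝ) else 0 := fun i => by
    split_ifs with h
    · rw [← sq_abs, ha.2 i h, div_pow, one_pow, Real.sq_sqrt k.cast_nonneg]
    · rw [not_ne_iff.1 h, zero_pow two_ne_zero]
  have hcard : (Finset.univ.filter fun i => a i ≠ 0).card = k := ha.1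
  rw [Finset.sum_congr rfl fun i _ => hsq i, ← Finset.sum_filter, Finset.sum_const, hcard,
    nsmul_eq_mul, mul_one_div_cancel hk0]

theorem exists_ne_zero_of_mem_flatVec (hk : 1 ≤ k) (ha : a ∈ flatVec m k) : ∃ i, a i ≠ 0 := by
  by_contra! hzero
  simpa [hzero] using sum_sq_of_mem_flatVec hk ha

theorem abs_intUnit_mul (u : ℤˣ) (x : ℝ) : |(u : ℤ) * x| = |x| := by
  rcases Int.units_eq_one_or u with rfl | rfl <;> simp

theorem exists_intUnit_mul_eq {x y : ℝ} (h : |x| = |y|) : ∃ u : ℤˣ, (u : ℤ) * x = y := by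
  rcases abs_eq_abs.1 h with rfl | rfl
  · exact ⟨1, by simp⟩
  · exact ⟨-1, by simp⟩

theorem signedPerm_mem_flatVec (ha : a ∈ flatVec m k) (σ : Equiv.Perm (Fin m))
    (ε : Fin m → ℤˣ) : (fun i => (ε i : ℤ) * a (σ i)) ∈ flatVec m k := by
  have hne : ∀ i, (ε i : ℤ) * a (σ i) ≠ 0 ↔ a (σ i) ≠ 0 := fun i => by
    rw [← abs_pos, abs_intUnit_mul, abs_pos]
  refine ⟨?_, fun i hi => ?_⟩
  · rw [← ha.1]
    exact Finset.card_equiv σ fun i => by simp only [Finset.mem_filter_univ, hne]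
  · rw [abs_intUnit_mul]
    exact ha.2 _ ((hne i).1 hi)

theorem neg_mem_flatVec (ha : a ∈ flatVec m k) : -a ∈ flatVec m k := by
  simpa [Pi.neg_def] using signedPerm_mem_flatVec ha 1 fun _ => -1

theorem exists_signedPerm_eq_of_mem_flatVec (ha : a ∈ flatVec m k) (hb : b ∈ flatVec m k) :
    ∃ (σ : Equiv.Perm (Fin m)) (ε : Fin m → ℤˣ), (fun i => (ε i : ℤ) * a (σ i)) = b := by
  have hcard : Fintype.card {i // b i ≠ 0} = Fintype.card {i // a i ≠ 0} := by
    rw [Fintype.card_subtype, Fintype.card_subtype]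
    exact hb.1.trans ha.1.symm
  let supportEquiv := Fintype.equivOfCardEq hcard
  have hsign : ∀ i, ∃ u : ℤˣ, (u : ℤ) * a (supportEquiv.extendSubtype i) = b i := fun i => by
    apply exists_intUnit_mul_eq
    by_cases hi : b i = 0
    · rw [not_ne_iff.1 (supportEquiv.extendSubtype_not_mem i (not_not.2 hi)), hi]
    · rw [ha.2 _ (supportEquiv.extendSubtype_mem i hi), hb.2 i hi]
  choose ε hε using hsign
  exact ⟨supportEquiv.extendSubtype, ε, funext hε⟩

/-- The flat vectors with support `s` and non-zero entries `± 1 / √k`: for `s` of cardinality `k`,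
these are the elements of `flatVec m k` supported on `s`, which are counted one support at a
time. -/
noncomputable def flatVecOn (k : ℕ) (s : Finset (Fin m)) : Finset (Fin m → ℝ) :=
  Fintype.piFinset fun i => if i ∈ s then {1 / Real.sqrt k, -(1 / Real.sqrt k)} else {0}

theorem mem_flatVecOn (hk : 1 ≤ k) {s : Finset (Fin m)} :
    a ∈ flatVecOn k s ↔
      Finset.univ.filter (a · ≠ 0) = s ∧ ∀ i, a i ≠ 0 → |a i| = 1 / Real.sqrt k := by
  have hpos : 0 < 1 / Real.sqrt k := by positivity
  have hentry : ∀ i, a i ∈ (if i ∈ s then {1 / Real.sqrt k, -(1 / Real.sqrt k)} else {0} :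
      Finset ℝ) ↔ (a i ≠ 0 ↔ i ∈ s) ∧ (a i ≠ 0 → |a i| = 1 / Real.sqrt k) := fun i => by
    generalize 1 / Real.sqrt k = c at hpos ⊢
    by_cases ha : a i = 0 <;> by_cases hi : i ∈ s <;>
      simp [ha, hi, abs_eq, hpos.le, hpos.ne, hpos.ne']
  rw [flatVecOn, Fintype.mem_piFinset, forall_congr' hentry, forall_and, Finset.ext_iff]
  simp only [Finset.mem_filter_univ]

theorem card_flatVecOn (hk : 1 ≤ k) (s : Finset (Fin m)) : (flatVecOn k s).card = 2 ^ s.card := by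
  have hpos : 0 < 1 / Real.sqrt k := by positivity
  have hpair : ({1 / Real.sqrt k, -(1 / Real.sqrt k)} : Finset ℝ).card = 2 :=
    Finset.card_pair (by linarith)
  simp only [flatVecOn, Fintype.card_piFinset, apply_ite Finset.card, hpair,
    Finset.card_singleton, Finset.prod_ite_mem, Finset.univ_inter, Finset.prod_const]

theorem flatVec_eq_coe_biUnion (hk : 1 ≤ k) :
    flatVec m k = ((Finset.univ.powersetCard k).biUnion (flatVecOn k) : Finset (Fin m → ℝ)) := by
  ext a
  simp [mem_flatVecOn hk, flatVec, hammingNorm]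

theorem finite_flatVec (hk : 1 ≤ k) : (flatVec m k).Finite :=
  flatVec_eq_coe_biUnion hk ▸ Finset.finite_toSet _

theorem ncard_flatVec (hk : 1 ≤ k) : (flatVec m k).ncard = 2 ^ k * m.choose k := by
  have hdisj : ((Finset.univ.powersetCard k : Finset (Finset (Fin m))) :
      Set (Finset (Fin m))).PairwiseDisjoint (flatVecOn k) := fun s _ t _ hst =>
    Finset.disjoint_left.2 fun a hs ht =>
      hst (((mem_flatVecOn hk).1 hs).1.symm.trans ((mem_flatVecOn hk).1 ht).1)
  rw [flatVec_eq_coe_biUnion hk, ncard_coe_finset, Finset.card_biUnion hdisj,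
    Finset.sum_congr rfl fun s hs => by
      rw [card_flatVecOn hk, (Finset.mem_powersetCard.1 hs).2],
    Finset.sum_const, Finset.card_powersetCard, Finset.card_fin, smul_eq_mul, mul_comm]

theorem nonempty_flatVec (hk : 1 ≤ k) (hkm : k ≤ m) : (flatVec m k).Nonempty := by
  refine nonempty_of_ncard_ne_zero ?_
  rw [ncard_flatVec hk]
  exact mul_ne_zero (by positivity) (Nat.choose_pos hkm).ne'

theorem exists_mem_flatVec_apply_ne_zero (hk : 1 ≤ k) (hkm : k ≤ m) (i : Fin m) :
    ∃ a ∈ flatVec m k, a i ≠ 0 := by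
  obtain ⟨a, ha⟩ := nonempty_flatVec hk hkm
  obtain ⟨j, hj⟩ := exists_ne_zero_of_mem_flatVec hk ha
  exact ⟨_, signedPerm_mem_flatVec ha (Equiv.swap i j) 1, by simpa using hj⟩

theorem update_neg_mem_flatVec (ha : a ∈ flatVec m k) (i : Fin m) :
    Function.update a i (-a i) ∈ flatVec m k := by
  convert signedPerm_mem_flatVec ha 1 (Function.update 1 i (-1)) using 1
  ext j
  by_cases hj : j = i
  · subst hj
    simp
  · simp [hj]

theorem span_flatVec (hk : 1 ≤ k) (hkm : k ≤ m) : Submodule.span ℝ (flatVec m k) = ⊤ := by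
  rw [eq_top_iff, ← (Pi.basisFun ℝ (Fin m)).span_eq, Submodule.span_le]
  rintro _ ⟨i, rfl⟩
  obtain ⟨a, ha, hai⟩ := exists_mem_flatVec_apply_ne_zero hk hkm i
  have hsingle : Pi.basisFun ℝ (Fin m) i = (2 * a i)⁻¹ • (a - Function.update a i (-a i)) := by
    ext j
    by_cases hj : j = i
    · subst hj
      simp [← two_mul, hai, -mul_inv_rev]
    · simp [hj]
  rw [hsingle]
  exact Submodule.smul_mem _ _ (Submodule.sub_mem _ (Submodule.subset_span ha)
    (Submodule.subset_span (update_neg_mem_flatVec ha i)))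

end FlatVec

section CutAtoms

variable {m₁ m₂ k q : ℕ}

theorem cutAtoms_eq_image2 :
    cutAtoms m₁ m₂ k q = image2 outer (flatVec m₁ k) (flatVec m₂ q) := by
  ext A
  simp only [cutAtoms, mem_ofPred_eq, mem_image2, eq_comm]

theorem finite_cutAtoms (hk : 1 ≤ k) (hq : 1 ≤ q) : (cutAtoms m₁ m₂ k q).Finite := by
  rw [cutAtoms_eq_image2]
  exact (finite_flatVec hk).image2 outer (finite_flatVec hq)

theorem nonempty_cutAtoms (hk : 1 ≤ k) (hkm : k ≤ m₁) (hq : 1 ≤ q) (hqm : q ≤ m₂) :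
    (cutAtoms m₁ m₂ k q).Nonempty := by
  rw [cutAtoms_eq_image2]
  exact (nonempty_flatVec hk hkm).image2 (nonempty_flatVec hq hqm)

theorem neg_mem_cutAtoms {A : RMat m₁ m₂} (hA : A ∈ cutAtoms m₁ m₂ k q) :
    -A ∈ cutAtoms m₁ m₂ k q := by
  obtain ⟨a, ha, b, hb, rfl⟩ := hA
  exact ⟨-a, neg_mem_flatVec ha, b, hb, by ext; simp [outer]⟩

theorem norm_eq_one_of_mem_cutAtoms (hk : 1 ≤ k) (hq : 1 ≤ q) {A : RMat m₁ m₂}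
    (hA : A ∈ cutAtoms m₁ m₂ k q) : ‖A‖ = 1 := by
  obtain ⟨a, ha, b, hb, rfl⟩ := hA
  rw [EuclideanSpace.norm_eq, Real.sqrt_eq_one, Fintype.sum_prod_type]
  simp only [outer, Real.norm_eq_abs, sq_abs, mul_pow]
  rw [← Finset.sum_mul_sum, sum_sq_of_mem_flatVec hk ha, sum_sq_of_mem_flatVec hq hb, one_mul]

theorem span_cutAtoms (hk : 1 ≤ k) (hkm : k ≤ m₁) (hq : 1 ≤ q) (hqm : q ≤ m₂) :
    Submodule.span ℝ (cutAtoms m₁ m₂ k q) = ⊤ := by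
  let outerBilin : (Fin m₁ → ℝ) →ₗ[ℝ] (Fin m₂ → ℝ) →ₗ[ℝ] RMat m₁ m₂ :=
    LinearMap.mk₂ ℝ outer (fun _ _ _ => by ext; simp [outer, add_mul])
      (fun _ _ _ => by ext; simp [outer, mul_assoc]) (fun _ _ _ => by ext; simp [outer, mul_add])
      (fun _ _ _ => by ext; simp [outer, mul_left_comm])
  have hspan : Submodule.span ℝ (cutAtoms m₁ m₂ k q) = Submodule.map₂ outerBilin ⊤ ⊤ := by
    rw [← span_flatVec hk hkm, ← span_flatVec hq hqm, Submodule.map₂_span_span, cutAtoms_eq_image2]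
    rfl
  rw [hspan, eq_top_iff, ← (EuclideanSpace.basisFun (Fin m₁ × Fin m₂) ℝ).toBasis.span_eq,
    Submodule.span_le]
  rintro _ ⟨p, rfl⟩
  have hsingle : EuclideanSpace.single p (1 : ℝ) =
      outerBilin (Pi.single p.1 1) (Pi.single p.2 1) := by
    ext r
    simp [outerBilin, outer, Pi.single_apply, Prod.ext_iff, ← ite_and, and_comm]
  rw [OrthonormalBasis.coe_toBasis, EuclideanSpace.basisFun_apply, hsingle]
  exact Submodule.apply_mem_map₂ _ trivial trivial

theorem isIsometryTransitive_cutAtoms (hk : 1 ≤ k) (hq : 1 ≤ q) :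
    IsIsometryTransitive (cutAtoms m₁ m₂ k q) := by
  rintro _ ⟨a, ha, b, hb, rfl⟩ _ ⟨a', ha', b', hb', rfl⟩
  obtain ⟨σ, ε, haa'⟩ := exists_signedPerm_eq_of_mem_flatVec ha ha'
  obtain ⟨τ, δ, hbb'⟩ := exists_signedPerm_eq_of_mem_flatVec hb hb'
  let φ : RMat m₁ m₂ ≃ₗᵢ[ℝ] RMat m₁ m₂ :=
    signedPerm (σ.prodCongr τ) fun p => ε p.1 * δ p.2
  have hφ_outer : ∀ (c : Fin m₁ → ℝ) (d : Fin m₂ → ℝ), φ (outer c d) =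
      outer (fun i => (ε i : ℤ) * c (σ i)) (fun j => (δ j : ℤ) * d (τ j)) := fun c d => by
    ext p
    rw [signedPerm_apply]
    simp only [outer, Equiv.prodCongr_apply, Prod.map_fst, Prod.map_snd, Units.val_mul,
      Int.cast_mul]
    ring
  have hφ_subset : φ '' cutAtoms m₁ m₂ k q ⊆ cutAtoms m₁ m₂ k q := by
    rintro _ ⟨_, ⟨c, hc, d, hd, rfl⟩, rfl⟩
    exact ⟨_, signedPerm_mem_flatVec hc σ ε, _, signedPerm_mem_flatVec hd τ δ, hφ_outer c d⟩
  exact ⟨φ, eq_of_subset_of_ncard_le hφ_subset (ncard_image_of_injective _ φ.injective).ge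
    (finite_cutAtoms hk hq), by rw [hφ_outer, haa', hbb']⟩

theorem outer_eq_outer_iff (hk : 1 ≤ k) (hq : 1 ≤ q) {a a' : Fin m₁ → ℝ} {b b' : Fin m₂ → ℝ}
    (ha : a ∈ flatVec m₁ k) (ha' : a' ∈ flatVec m₁ k) (hb : b ∈ flatVec m₂ q) :
    outer a' b' = outer a b ↔ (a' = a ∧ b' = b) ∨ (a' = -a ∧ b' = -b) := by
  refine ⟨fun h => ?_, ?_⟩
  · have hmul : ∀ i j, a' i * b' j = a i * b j := fun i j =>
      congrArg (fun Z : RMat m₁ m₂ => Z (i, j)) h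
    obtain ⟨i, hi⟩ := exists_ne_zero_of_mem_flatVec hk ha
    obtain ⟨j, hj⟩ := exists_ne_zero_of_mem_flatVec hq hb
    have hi' : a' i ≠ 0 := left_ne_zero_of_mul (hmul i j ▸ mul_ne_zero hi hj)
    rcases abs_eq_abs.1 ((ha'.2 i hi').trans (ha.2 i hi).symm) with hsign | hsign
    · have hb' : b' = b := funext fun j => mul_left_cancel₀ hi (hsign ▸ hmul i j)
      exact .inl ⟨funext fun i => mul_right_cancel₀ hj (hb' ▸ hmul i j), hb'⟩
    · have hb' : b' = -b := funext fun j => mul_left_cancel₀ hi' (by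
        rw [hmul, hsign, Pi.neg_apply, neg_mul_neg])
      refine .inr ⟨funext fun i => mul_right_cancel₀ (neg_ne_zero.2 hj) ?_, hb'⟩
      rw [Pi.neg_apply, neg_mul_neg, ← hmul, hb', Pi.neg_apply]
  · rintro (⟨rfl, rfl⟩ | ⟨rfl, rfl⟩)
    · rfl
    · ext
      simp [outer]

theorem ncard_setOf_outer_eq_outer (hk : 1 ≤ k) (hq : 1 ≤ q) {a : Fin m₁ → ℝ} {b : Fin m₂ → ℝ}
    (ha : a ∈ flatVec m₁ k) (hb : b ∈ flatVec m₂ q) :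
    {p ∈ flatVec m₁ k ×ˢ flatVec m₂ q | outer p.1 p.2 = outer a b}.ncard = 2 := by
  have hpair : {p ∈ flatVec m₁ k ×ˢ flatVec m₂ q | outer p.1 p.2 = outer a b} =
      {(a, b), (-a, -b)} := by
    ext ⟨a', b'⟩
    simp only [mem_ofPred_eq, mem_prod, mem_insert_iff, mem_singleton_iff, Prod.mk.injEq]
    constructor
    · rintro ⟨⟨ha', -⟩, h⟩
      exact (outer_eq_outer_iff hk hq ha ha' hb).1 h
    · rintro (⟨rfl, rfl⟩ | ⟨rfl, rfl⟩)
      · exact ⟨⟨ha, hb⟩, rfl⟩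
      · have ha' := neg_mem_flatVec ha
        exact ⟨⟨ha', neg_mem_flatVec hb⟩,
          (outer_eq_outer_iff hk hq ha ha' hb).2 (.inr ⟨rfl, rfl⟩)⟩
  obtain ⟨i, hi⟩ := exists_ne_zero_of_mem_flatVec hk ha
  rw [hpair, ncard_pair fun h => hi (self_eq_neg.1 (congrFun (congrArg Prod.fst h) i))]

theorem two_mul_ncard_cutAtoms (hk : 1 ≤ k) (hq : 1 ≤ q) :
    2 * (cutAtoms m₁ m₂ k q).ncard = (flatVec m₁ k).ncard * (flatVec m₂ q).ncard := by
  classical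
  have hfin := (finite_flatVec (m := m₁) hk).prod (finite_flatVec (m := m₂) hq)
  have himage : (hfin.toFinset.image fun p => outer p.1 p.2 : Set (RMat m₁ m₂)) =
      cutAtoms m₁ m₂ k q := by
    rw [Finset.coe_image, hfin.coe_toFinset, cutAtoms_eq_image2, image_prod]
  have hfiber : ∀ A ∈ hfin.toFinset.image fun p => outer p.1 p.2,
      (hfin.toFinset.filter fun p => outer p.1 p.2 = A).card = 2 := by
    simp only [Finset.forall_mem_image, hfin.mem_toFinset]
    rintro ⟨a, b⟩ ⟨ha, hb⟩
    simpa only [← ncard_coe_finset, Finset.coe_filter, hfin.mem_toFinset] using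
      ncard_setOf_outer_eq_outer hk hq ha hb
  calc 2 * (cutAtoms m₁ m₂ k q).ncard
      = 2 * (hfin.toFinset.image fun p => outer p.1 p.2).card := by
        rw [← himage, ncard_coe_finset]
    _ = hfin.toFinset.card := by
        rw [Finset.card_eq_sum_card_image (fun p => outer p.1 p.2) hfin.toFinset,
          Finset.sum_congr rfl hfiber, Finset.sum_const, smul_eq_mul, mul_comm]
    _ = (flatVec m₁ k).ncard * (flatVec m₂ q).ncard := by
        rw [← ncard_eq_toFinset_card _ hfin, ncard_prod]

theorem ncard_cutAtoms (hk : 1 ≤ k) (hq : 1 ≤ q) :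
    (cutAtoms m₁ m₂ k q).ncard = 2 ^ (k + q - 1) * m₁.choose k * m₂.choose q := by
  have hpow : 2 ^ (k + q) = 2 * 2 ^ (k + q - 1) := by
    rw [← pow_succ', Nat.sub_add_cancel (by lia)]
  refine Nat.eq_of_mul_eq_mul_left two_pos ?_
  calc 2 * (cutAtoms m₁ m₂ k q).ncard
      = 2 ^ k * m₁.choose k * (2 ^ q * m₂.choose q) := by
        rw [two_mul_ncard_cutAtoms hk hq, ncard_flatVec hk, ncard_flatVec hq]
    _ = 2 ^ (k + q) * (m₁.choose k * m₂.choose q) := by ring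
    _ = 2 * (2 ^ (k + q - 1) * m₁.choose k * m₂.choose q) := by rw [hpow]; ring

end CutAtoms

section Entropy

theorem log_choose_le {m k : ℕ} (hk : 1 ≤ k) (hkm : k ≤ m) :
    Real.log (m.choose k) ≤ k + k * Real.log ((m : ℝ) / k) := by
  have hm : 1 ≤ m := hk.trans hkm
  have hchoose : (0 : ℝ) < m.choose k := mod_cast Nat.choose_pos hkm
  calc Real.log (m.choose k) ≤ Real.log (Real.exp k * ((m : ℝ) / k) ^ k) := by
        gcongr
        calc (m.choose k : ℝ) ≤ (m : ℝ) ^ k / k.factorial := Nat.choose_le_pow_div k m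
          _ = (k : ℝ) ^ k / k.factorial * ((m : ℝ) / k) ^ k := by rw [div_pow]; field_simp
          _ ≤ Real.exp k * ((m : ℝ) / k) ^ k := by
            gcongr
            exact Real.pow_div_factorial_le_exp _ k.cast_nonneg k
    _ = k + k * Real.log ((m : ℝ) / k) := by
        rw [Real.log_mul (Real.exp_pos _).ne' (by positivity), Real.log_exp, Real.log_pow]

theorem mul_log_div_nonneg {m k : ℕ} (hkm : k ≤ m) : 0 ≤ k * Real.log ((m : ℝ) / k) := by
  rcases k.eq_zero_or_pos with rfl | hk
  · simp
  · have hone : (1 : ℝ) ≤ m / k := (one_le_div (by positivity)).2 (mod_cast hkm)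
    positivity [Real.log_nonneg hone]

theorem four_mul_log_ncard_cutAtoms_le {m₁ m₂ k q : ℕ} (hk : 1 ≤ k) (hkm : k ≤ m₁) (hq : 1 ≤ q)
    (hqm : q ≤ m₂) :
    4 * Real.log (cutAtoms m₁ m₂ k q).ncard ≤ 16 * ((k : ℝ) + q) +
      9 * (k * Real.log ((m₁ : ℝ) / k) + q * Real.log ((m₂ : ℝ) / q)) := by
  have hchoose₁ : (m₁.choose k : ℝ) ≠ 0 := mod_cast (Nat.choose_pos hkm).ne'
  have hchoose₂ : (m₂.choose q : ℝ) ≠ 0 := mod_cast (Nat.choose_pos hqm).ne'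
  have hlog : Real.log (cutAtoms m₁ m₂ k q).ncard =
      (k + q - 1 : ℕ) * Real.log 2 + Real.log (m₁.choose k) + Real.log (m₂.choose q) := by
    rw [ncard_cutAtoms hk hq]
    push_cast
    rw [Real.log_mul (by positivity) hchoose₂, Real.log_mul (by positivity) hchoose₁, Real.log_pow]
  have hsigns : ((k + q - 1 : ℕ) : ℝ) * Real.log 2 ≤ k + q :=
    calc ((k + q - 1 : ℕ) : ℝ) * Real.log 2 ≤ (k + q : ℕ) * 1 := by
          gcongr
          · exact Nat.sub_le _ _
          · linarith [Real.log_le_sub_one_of_pos (two_pos (α := ℝ))]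
      _ = k + q := by push_cast; ring
  linarith [log_choose_le hk hkm, log_choose_le hq hqm, mul_log_div_nonneg hkm,
    mul_log_div_nonneg hqm]

end Entropy

end SparseCut

theorem mainTheorem9 (m₁ m₂ k q : ℕ) (hk : 1 ≤ k) (hkm : k ≤ m₁) (hq : 1 ≤ q) (hqm : q ≤ m₂) :
    (∀ A ∈ SparseCut.cutAtoms m₁ m₂ k q,
      MeasureTheory.Integrable (SparseCut.sqNormProj (SparseCut.cutNorm m₁ m₂ k q) A)
        (ProbabilityTheory.stdGaussian (SparseCut.RMat m₁ m₂)) ∧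
      SparseCut.statDim (SparseCut.cutNorm m₁ m₂ k q) A ≤
        16 * ((k : ℝ) + q) +
          9 * (k * Real.log ((m₁ : ℝ) / k) + q * Real.log ((m₂ : ℝ) / q))) ∧
    SparseCut.IsVertexTransitivePolytope {Z | SparseCut.cutNorm m₁ m₂ k q Z ≤ 1} ∧
    Set.extremePoints ℝ {Z | SparseCut.cutNorm m₁ m₂ k q Z ≤ 1} =
      SparseCut.cutAtoms m₁ m₂ k q ∧
    (Set.extremePoints ℝ {Z | SparseCut.cutNorm m₁ m₂ k q Z ≤ 1}).ncard =
      2 ^ (k + q - 1) * m₁.choose k * m₂.choose q := by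
  have hfin := SparseCut.finite_cutAtoms (m₁ := m₁) (m₂ := m₂) hk hq
  have htrans := SparseCut.isIsometryTransitive_cutAtoms (m₁ := m₁) (m₂ := m₂) hk hq
  have hnhds : convexHull ℝ (SparseCut.cutAtoms m₁ m₂ k q) ∈ nhds 0 :=
    SparseCut.convexHull_mem_nhds_zero (SparseCut.nonempty_cutAtoms hk hkm hq hqm)
      (fun _ => SparseCut.neg_mem_cutAtoms) (SparseCut.span_cutAtoms hk hkm hq hqm)
  have hball : {Z | SparseCut.cutNorm m₁ m₂ k q Z ≤ 1} =
      convexHull ℝ (SparseCut.cutAtoms m₁ m₂ k q) :=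
    SparseCut.setOf_atomicNorm_le_one hfin hnhds
  have hextreme : Set.extremePoints ℝ (convexHull ℝ (SparseCut.cutAtoms m₁ m₂ k q)) =
      SparseCut.cutAtoms m₁ m₂ k q :=
    SparseCut.extremePoints_convexHull_eq_of_norm_eq one_ne_zero fun _ =>
      SparseCut.norm_eq_one_of_mem_cutAtoms hk hq
  rw [hball, hextreme]
  exact ⟨fun A hA => ⟨SparseCut.integrable_sqNormProj _ A,
      (htrans.statDim_atomicNorm_le hfin hnhds hA).trans
        (SparseCut.four_mul_log_ncard_cutAtoms_le hk hkm hq hqm)⟩,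
    htrans.isVertexTransitivePolytope hfin, rfl, SparseCut.ncard_cutAtoms hk hq⟩
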